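/- All Hilbert spaces are complex. Let $T$ be a bounded linear operator on a Hilbert space $\mathcal H$. We call $T$ a *2-isometry* if $I-2T^*T+T^{*2}T^2=0$; we say that $T$ satisfies the *kernel condition* if $T^*T(\ker T^*)\subseteq\ker T^*$; and we call $T$ *completely non-unitary* if there is no nonzero closed subspace $\mathcal L\subseteq\mathcal H$ reducing $T$ such that $T|_{\mathcal L}$ is a unitary operator on $\mathcal L$. The *order of multicyclicity* of $T$ is the smallest cardinal $\mathfrak n$ for which there is a closed subspace $\mathcal N\subseteq\mathcal H$ of orthogonal dimension $\mathfrak n$ such that $\mathcal H$ is the closed linear span of $\bigcup_{n\ge 0}T^n(\mathcal N)$; $T$ is *finitely multicyclic* if this order is finite. A *unilateral weighted shift* is a bounded operator $S$ on $\ell^2=\ell^2(\{0,1,2,\dots\})$ of the form $S(h_0,h_1,\dots)=(0,w_0h_0,w_1h_1,\dots)$ with a bounded sequence $(w_n)_{n\ge0}$ of complex numbers. The orthogonal sum of a uniformly bounded family $(S_j)_{j\in J}$ of such operators acts coordinatewise on $\bigoplus_{j\in J}\ell^2$ (the empty sum acts on $\{0\}$). **Corollary 3.7.** If $T$ is a finitely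 multicyclic, completely non-unitary 2-isometry satisfying the kernel condition, then $T$ is unitarily equivalent to an orthogonal sum of $\mathfrak n$ unilateral weighted shifts, where $\mathfrak n$ is the order of multicyclicity of $T$. Moreover, for every cardinal number $\mathfrak n\ge\aleph_0$ there exists a completely non-unitary 2-isometry which satisfies the kernel condition, whose order of multicyclicity equals $\mathfrak n$, and which is not unitarily equivalent to any orthogonal sum of unilateral weighted shifts (with any index set). -/

import Mathlib

universe u v

namespace TwoIsom

open ContinuousLinearMap (adjoint)

section Operators

variable {H : Type u} [NormedAddCommGroup H] [InnerProductSpace ℂ H] [CompleteSpace H]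

/-- `T` is a `2`-isometry: `I - 2 T^* T + T^{*2} T^2 = 0`. -/
def IsTwoIsometry (T : H →L[ℂ] H) : Prop :=
  1 - (2 : ℂ) • (adjoint T * T) + adjoint T ^ 2 * T ^ 2 = 0

/-- The kernel condition `T^* T (ker T^*) ⊆ ker T^*`. -/
def KernelCondition (T : H →L[ℂ] H) : Prop :=
  ∀ x : H, adjoint T x = 0 → adjoint T ((adjoint T * T) x) = 0

/-- The subspace `L` reduces `T`: it is invariant under both `T` and `T^*`. -/
def Reduces (T : H →L[ℂ] H) (L : Submodule ℂ H) : Prop :=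
  (∀ x ∈ L, T x ∈ L) ∧ ∀ x ∈ L, adjoint T x ∈ L

/-- `T` is completely non-unitary: there is no nonzero closed subspace reducing `T` on which `T`
restricts to a unitary operator. -/
def CompletelyNonUnitary (T : H →L[ℂ] H) : Prop :=
  ¬ ∃ L : Submodule ℂ H, L ≠ ⊥ ∧ IsClosed (L : Set H) ∧ Reduces T L ∧
    ∃ U : L ≃ₗᵢ[ℂ] L, ∀ x : L, ((U x : L) : H) = T x

end Operators

/-- The orthogonal dimension of a Hilbert space: the (least) cardinality of an orthonormal basis.
A Hilbert space has an orthonormal basis, and all of them have the same cardinality. -/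
noncomputable def orthDim (E : Type u) [NormedAddCommGroup E] [InnerProductSpace ℂ E] :
    Cardinal.{u} :=
  sInf {c | ∃ ι : Type u, Nonempty (HilbertBasis ι ℂ E) ∧ Cardinal.mk ι = c}

section Multicyclicity

variable {H : Type u} [NormedAddCommGroup H] [InnerProductSpace ℂ H]

/-- The order of multicyclicity of `T`: the smallest orthogonal dimension of a closed subspace `N`
such that the closed linear span of all the subspaces `T^n(N)`, `n = 0, 1, 2, …`, is the whole
space. -/
noncomputable def orderOfMulticyclicity (T : H →L[ℂ] H) : Cardinal.{u} :=
  sInf {c | ∃ N : Submodule ℂ H, IsClosed (N : Set H) ∧ orthDim N = c ∧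
    (⨆ n : ℕ, N.map ((T ^ n : H →L[ℂ] H) : H →ₗ[ℂ] H)).topologicalClosure = ⊤}

/-- `T` is finitely multicyclic: its order of multicyclicity is finite. -/
def FinitelyMulticyclic (T : H →L[ℂ] H) : Prop :=
  orderOfMulticyclicity T < Cardinal.aleph0

end Multicyclicity

/-- Unitary equivalence of bounded operators on two Hilbert spaces. -/
def UnitarilyEquivalent {H : Type u} [NormedAddCommGroup H] [InnerProductSpace ℂ H]
    {K : Type v} [NormedAddCommGroup K] [InnerProductSpace ℂ K]
    (T : H →L[ℂ] H) (S : K →L[ℂ] K) : Prop :=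
  ∃ U : H ≃ₗᵢ[ℂ] K, ∀ x : H, U (T x) = S (U x)

/-- The Hilbert space of square summable complex sequences indexed by `0, 1, 2, …`. -/
abbrev EllTwo : Type := lp (fun _ : ℕ => ℂ) 2

/-- `S` is a unilateral weighted shift: `S (h 0, h 1, …) = (0, w 0 * h 0, w 1 * h 1, …)` for some
sequence `w` of complex weights (automatically bounded, as `S` is a bounded operator). -/
def IsUnilateralWeightedShift (S : EllTwo →L[ℂ] EllTwo) : Prop :=
  ∃ w : ℕ → ℂ, ∀ h : EllTwo, S h 0 = 0 ∧ ∀ n : ℕ, S h (n + 1) = w n * h n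

/-- `A` is the orthogonal sum of the operators `S j`, acting coordinatewise on the Hilbert space
orthogonal sum of the spaces on which the `S j` act. These equations determine `A`, and a bounded
`A` satisfying them exists exactly when the family `S` is uniformly bounded. -/
def IsOrthogonalSum {J : Type v} (S : J → EllTwo →L[ℂ] EllTwo)
    (A : lp (fun _ : J => EllTwo) 2 →L[ℂ] lp (fun _ : J => EllTwo) 2) : Prop :=
  ∀ (x : lp (fun _ : J => EllTwo) 2) (j : J), A x j = S j (x j)

/-- `T` is unitarily equivalent to an orthogonal sum of unilateral weighted shifts indexed
by `J`. -/
def EquivOrthogonalSumOfShifts {H : Type u} [NormedAddCommGroup H] [InnerProductSpace ℂ H]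
    (T : H →L[ℂ] H) (J : Type v) : Prop :=
  ∃ (S : J → EllTwo →L[ℂ] EllTwo)
    (A : lp (fun _ : J => EllTwo) 2 →L[ℂ] lp (fun _ : J => EllTwo) 2),
    (∀ j, IsUnilateralWeightedShift (S j)) ∧ IsOrthogonalSum S A ∧ UnitarilyEquivalent T A

end TwoIsom

namespace TwoIsom

open ContinuousLinearMap (adjoint)

/-! ### Wandering subspace structure of 2-isometries under the kernel condition. -/

section Structure

variable {H : Type u} [NormedAddCommGroup H] [InnerProductSpace ℂ H] [CompleteSpace H]
  {T : H →L[ℂ] H}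

/-! For a 2-isometry, `⟨Tⁿx, Tⁿy⟩` is affine in `n`. With the kernel condition this makes the spaces
`Tᵏ(ker T*)` mutually orthogonal. A vector orthogonal to all of them lies in every range `ran Tⁿ`.
The intersection of these ranges reduces `T` to a unitary, so it is zero when `T` is completely
non-unitary. Hence `ker T*` generates `H`. Conversely, any generating subspace projects densely onto
`ker T*`, because `ker T*` is orthogonal to `ran T`. The order of multicyclicity is therefore `dim
ker T*` (`orderOfMulticyclicity_eq_mk`).

If this dimension is finite, `T*T` restricted to `ker T*` has an orthonormal eigenbasis, and the
orbit of each eigenvector spans one weighted shift.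

For infinite `n` diagonalization can fail. An orthogonal sum of shifts on a nonzero space always has
an eigenvector of `T*T` in `ker T*`. An operator weighted shift can be built so that `T*T` on `ker
T*` is a copy of `1 + C*C` for any prescribed `C`. Taking `C = 1 + S` with `S` a shift of
multiplicity `n` gives `C*C = 2 + S + S*`, which has no eigenvectors. -/

theorem isTwoIsometry_iff_inner :
    IsTwoIsometry T ↔ ∀ x y : H,
      inner ℂ (T (T x)) (T (T y)) = 2 * inner ℂ (T x) (T y) - inner ℂ x y := by
  have key : ∀ x y : H, inner ℂ x
      ((1 - (2 : ℂ) • (adjoint T * T) + adjoint T ^ 2 * T ^ 2 : H →L[ℂ] H) y) =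
      inner ℂ x y - 2 * inner ℂ (T x) (T y) + inner ℂ (T (T x)) (T (T y)) := by
    intro x y
    simp [pow_two, ContinuousLinearMap.adjoint_inner_right]
  constructor
  · intro h x y
    have := key x y
    rw [show (1 - (2 : ℂ) • (adjoint T * T) + adjoint T ^ 2 * T ^ 2 : H →L[ℂ] H) = 0 from h] at this
    simp only [zero_apply, inner_zero_right] at this
    linear_combination -this
  · intro h
    refine ContinuousLinearMap.ext fun y => ext_inner_left ℂ fun x => ?_
    rw [key, h]
    simp

/-- The defining identity says that the second difference of `n ↦ ⟨Tⁿx, Tⁿy⟩` vanishes. -/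
theorem IsTwoIsometry.inner_pow (h : IsTwoIsometry T) (n : ℕ) (x y : H) :
    inner ℂ ((T ^ n) x) ((T ^ n) y) =
      inner ℂ x y + n * (inner ℂ (T x) (T y) - inner ℂ x y) := by
  induction n generalizing x y with
  | zero => simp
  | succ n ih =>
    rw [pow_succ, mul_apply_eq_comp, mul_apply_eq_comp, ih,
      isTwoIsometry_iff_inner.1 h]
    push_cast
    ring

theorem IsTwoIsometry.norm_pow_sq (h : IsTwoIsometry T) (n : ℕ) (x : H) :
    ‖(T ^ n) x‖ ^ 2 = ‖x‖ ^ 2 + n * (‖T x‖ ^ 2 - ‖x‖ ^ 2) := by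
  have := h.inner_pow n x x
  simp only [inner_self_eq_norm_sq_to_K, Complex.coe_algebraMap] at this
  exact_mod_cast this

/-- An affine function of `n` that stays nonnegative, here `‖Tⁿx‖²`, has nonnegative slope. -/
theorem IsTwoIsometry.norm_le (h : IsTwoIsometry T) (x : H) : ‖x‖ ≤ ‖T x‖ := by
  by_contra! hlt
  have hd : 0 < ‖x‖ ^ 2 - ‖T x‖ ^ 2 := by
    have := norm_nonneg (T x)
    nlinarith
  obtain ⟨n, hn⟩ := exists_nat_gt (‖x‖ ^ 2 / (‖x‖ ^ 2 - ‖T x‖ ^ 2))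
  rw [div_lt_iff₀ hd] at hn
  have h1 := h.norm_pow_sq n x
  have h2 := sq_nonneg ‖(T ^ n) x‖
  nlinarith

theorem IsTwoIsometry.injective (h : IsTwoIsometry T) : Function.Injective T := by
  refine (injective_iff_map_eq_zero T).2 fun x hx => ?_
  have := h.norm_le x
  rw [hx, norm_zero] at this
  simpa using this

theorem IsTwoIsometry.isClosed_range (h : IsTwoIsometry T) : IsClosed (Set.range T) := by
  have : AntilipschitzWith 1 T := T.antilipschitz_of_bound (K := 1) fun x => by
    simpa using h.norm_le x
  exact this.isClosed_range T.uniformContinuous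

/-- Images of `ker T^*` under lower powers of `T` are orthogonal to the ranges of higher powers. -/
theorem inner_pow_pow_eq_zero (h : IsTwoIsometry T) (hk : KernelCondition T) {e : H}
    (he : adjoint T e = 0) {k n : ℕ} (hkn : k < n) (x : H) :
    inner ℂ ((T ^ n) x) ((T ^ k) e) = 0 := by
  obtain ⟨m, rfl⟩ : ∃ m, n = k + (1 + m) := ⟨n - k - 1, by omega⟩
  have hz : ∀ u : H, inner ℂ (T u) e = 0 := fun u => by
    rw [← ContinuousLinearMap.adjoint_inner_right, he, inner_zero_right]
  have hz' : ∀ u : H, inner ℂ (T (T u)) (T e) = 0 := fun u => by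
    rw [← ContinuousLinearMap.adjoint_inner_right, ← ContinuousLinearMap.adjoint_inner_right]
    have := hk e he
    rw [mul_apply_eq_comp] at this
    rw [this, inner_zero_right]
  -- Cancelling `Tᵏ` by `inner_pow` leaves only `⟨Tu, e⟩` and `⟨TTu, Te⟩`; the second vanishes by
  -- the kernel condition.
  rw [pow_add, pow_add, pow_one, mul_apply_eq_comp, mul_apply_eq_comp,
    h.inner_pow, hz, hz']
  simp

theorem inner_pow_pow_eq_zero' (h : IsTwoIsometry T) (hk : KernelCondition T) {e : H}
    (he : adjoint T e = 0) {k n : ℕ} (hkn : k < n) (x : H) :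
    inner ℂ ((T ^ k) e) ((T ^ n) x) = 0 :=
  inner_eq_zero_symm.1 (inner_pow_pow_eq_zero h hk he hkn x)

theorem exists_eq_add_apply (h : IsTwoIsometry T) (y : H) :
    ∃ e z : H, adjoint T e = 0 ∧ y = e + T z := by
  let K : Submodule ℂ H := LinearMap.range (T : H →ₗ[ℂ] H)
  have hK : IsClosed (K : Set H) := h.isClosed_range
  have : CompleteSpace K := hK.completeSpace_coe
  obtain ⟨a, ⟨z, hz⟩, b, hb, hab⟩ := K.exists_add_mem_mem_orthogonal y
  refine ⟨b, z, ?_, ?_⟩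
  · refine ext_inner_left ℂ fun x => ?_
    rw [ContinuousLinearMap.adjoint_inner_right, inner_zero_right]
    exact hb _ ⟨x, rfl⟩
  · rw [hab, ← hz, add_comm]; rfl

/-- If `x = Tⁿ(e + Tz)` with `e ∈ ker T*`, then `Tⁿe` is orthogonal both to `x` and to `Tⁿ⁺¹z`, so
it is zero and one more power of `T` factors out. -/
theorem mem_range_pow_of_orthogonal (h : IsTwoIsometry T) (hk : KernelCondition T) {x : H}
    (hx : ∀ e, adjoint T e = 0 → ∀ k, inner ℂ ((T ^ k) e) x = 0) (n : ℕ) :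
    ∃ y, (T ^ n) y = x := by
  induction n with
  | zero => exact ⟨x, by simp⟩
  | succ n ih =>
    obtain ⟨y, rfl⟩ := ih
    obtain ⟨e, z, he, rfl⟩ := exists_eq_add_apply h y
    have hz : (T ^ n) (T z) = (T ^ (n + 1)) z := by
      rw [pow_succ, mul_apply_eq_comp]
    have h1 := hx e he n
    rw [map_add, inner_add_right, hz, inner_pow_pow_eq_zero' h hk he (Nat.lt_succ_self n),
      add_zero, inner_self_eq_zero] at h1
    exact ⟨z, by rw [map_add, h1, zero_add, hz]⟩

/-- A completely non-unitary `2`-isometry is analytic. -/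
theorem eq_zero_of_forall_mem_range_pow (h : IsTwoIsometry T) (hc : CompletelyNonUnitary T) {x : H}
    (hx : ∀ n, ∃ y, (T ^ n) y = x) : x = 0 := by
  let L : Submodule ℂ H := ⨅ n : ℕ, LinearMap.range ((T ^ n : H →L[ℂ] H) : H →ₗ[ℂ] H)
  have memL : ∀ {z : H}, z ∈ L ↔ ∀ n, ∃ y, (T ^ n) y = z := by
    intro z
    exact Submodule.mem_iInf _
  have hpre : ∀ z ∈ L, ∃ y ∈ L, T y = z := by
    intro z hz
    obtain ⟨y, hy⟩ := memL.1 hz 1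
    rw [pow_one] at hy
    refine ⟨y, memL.2 fun n => ?_, hy⟩
    obtain ⟨w, hw⟩ := memL.1 hz (n + 1)
    refine ⟨w, h.injective ?_⟩
    rw [← mul_apply_eq_comp, ← pow_succ', hw, hy]
  have hiso : ∀ z ∈ L, ‖T z‖ = ‖z‖ := by
    intro z hz
    refine le_antisymm ?_ (h.norm_le z)
    -- For `z = Tⁿy` the slope is the same at `z` and at `y`, and `‖z‖²` is `‖y‖²` plus `n` times
    -- it. Since `n` is arbitrary, the slope is not positive.
    have hn : ∀ n : ℕ, n * (‖T z‖ ^ 2 - ‖z‖ ^ 2) ≤ ‖z‖ ^ 2 := by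
      intro n
      obtain ⟨y, rfl⟩ := memL.1 hz n
      have e1 := h.norm_pow_sq n y
      have e2 := h.norm_pow_sq (n + 1) y
      rw [pow_succ' T, mul_apply_eq_comp] at e2
      rw [Nat.cast_succ] at e2
      nlinarith [sq_nonneg ‖y‖]
    by_contra! hlt
    have hd : 0 < ‖T z‖ ^ 2 - ‖z‖ ^ 2 := by
      have := norm_nonneg z
      nlinarith
    obtain ⟨n, hn'⟩ := exists_nat_gt (‖z‖ ^ 2 / (‖T z‖ ^ 2 - ‖z‖ ^ 2))
    rw [div_lt_iff₀ hd] at hn'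
    linarith [hn n]
  have hTL : ∀ z ∈ L, T z ∈ L := by
    intro z hz
    refine memL.2 fun n => ?_
    obtain ⟨y, rfl⟩ := memL.1 hz n
    exact ⟨T y, by rw [← mul_apply_eq_comp, ← mul_apply_eq_comp,
      ← pow_succ, pow_succ']⟩
  have hadj : ∀ z ∈ L, adjoint T (T z) = z := by
    intro z hz
    have hTT : ‖T (T z)‖ = ‖T z‖ := hiso _ (hTL z hz)
    -- the positive form `⟨Δ x, y⟩` vanishes at `z`
    have hform : ∀ w : H, ∀ t : ℝ, 0 ≤ ‖T (z + (t : ℂ) • w)‖ ^ 2 - ‖z + (t : ℂ) • w‖ ^ 2 := by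
      intro w t
      have := h.norm_le (z + (t : ℂ) • w)
      have h0 := norm_nonneg (z + (t : ℂ) • w)
      nlinarith
    have hre : ∀ w : H, Complex.re (inner ℂ (adjoint T (T z) - z) w) = 0 := by
      intro w
      set r := Complex.re (inner ℂ (adjoint T (T z) - z) w) with hr
      set d := ‖T w‖ ^ 2 - ‖w‖ ^ 2 with hd
      have hexp : ∀ t : ℝ, 0 ≤ 2 * t * r + t ^ 2 * d := by
        intro t
        have h1 := hform w t
        rw [map_add, map_smul, @norm_add_sq ℂ, @norm_add_sq ℂ, norm_smul, norm_smul,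
          inner_smul_right, inner_smul_right, hiso z hz] at h1
        rw [inner_sub_left, ContinuousLinearMap.adjoint_inner_left, Complex.sub_re] at hr
        have h2 : ∀ a : ℂ, RCLike.re ((t : ℂ) * a) = t * a.re := by
          intro a; simp
        rw [h2, h2, Complex.norm_real, mul_pow, mul_pow, Real.norm_eq_abs, sq_abs] at h1
        rw [hr, hd]
        linarith
      by_contra hne
      have hd0 : 0 ≤ d := by
        have := hexp 1
        have := hexp (-1)
        linarith
      have hr2 : 0 < r ^ 2 := by positivity
      -- Near the minimum of the quadratic in `t`; `d + 1` replaces `d` to allow `d = 0`.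
      have := hexp (-r / (d + 1))
      have h3 : 2 * (-r / (d + 1)) * r + (-r / (d + 1)) ^ 2 * d =
          -(r ^ 2 * (d + 2)) / (d + 1) ^ 2 := by
        field_simp
        ring
      rw [h3, le_div_iff₀ (by positivity)] at this
      nlinarith
    have hself := hre (adjoint T (T z) - z)
    have : RCLike.re (inner ℂ (adjoint T (T z) - z) (adjoint T (T z) - z)) = 0 := hself
    rw [inner_self_eq_norm_sq (𝕜 := ℂ)] at this
    exact sub_eq_zero.1 (norm_eq_zero.1 (pow_eq_zero_iff two_ne_zero |>.1 this))
  have hclosed : IsClosed (L : Set H) := by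
    rw [Submodule.coe_iInf]
    refine isClosed_iInter fun n => ?_
    have hb : AntilipschitzWith 1 (T ^ n) :=
      (T ^ n).antilipschitz_of_bound (K := 1) fun y => by
        have e1 := h.norm_pow_sq n y
        have e2 := h.norm_le y
        have : ‖y‖ ^ 2 ≤ ‖(T ^ n) y‖ ^ 2 := by
          rw [e1]
          have : 0 ≤ ‖T y‖ ^ 2 - ‖y‖ ^ 2 := by
            have := norm_nonneg y
            nlinarith
          have := mul_nonneg (Nat.cast_nonneg (α := ℝ) n) this
          linarith
        simpa using abs_le_of_sq_le_sq' this (norm_nonneg _) |>.2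
    exact hb.isClosed_range (T ^ n).uniformContinuous
  have hadjL : ∀ z ∈ L, adjoint T z ∈ L := by
    intro z hz
    obtain ⟨y, hy, rfl⟩ := hpre z hz
    rwa [hadj y hy]
  by_contra hx0
  have hxL : x ∈ L := memL.2 hx
  refine hc ⟨L, fun hL => hx0 ?_, hclosed, ⟨hTL, hadjL⟩, ?_⟩
  · rw [hL] at hxL
    simpa using hxL
  · let f : L →ₗᵢ[ℂ] L :=
      { toLinearMap := (T : H →ₗ[ℂ] H).restrict hTL
        norm_map' := fun z => hiso z z.2 }
    have hf : Function.Surjective f := by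
      rintro ⟨z, hz⟩
      obtain ⟨y, hy, hyz⟩ := hpre z hz
      exact ⟨⟨y, hy⟩, Subtype.ext hyz⟩
    exact ⟨LinearIsometryEquiv.ofSurjective f hf, fun z => rfl⟩

theorem eq_zero_of_orthogonal (h : IsTwoIsometry T) (hc : CompletelyNonUnitary T)
    (hk : KernelCondition T) {x : H}
    (hx : ∀ e, adjoint T e = 0 → ∀ k, inner ℂ ((T ^ k) e) x = 0) : x = 0 :=
  eq_zero_of_forall_mem_range_pow h hc (mem_range_pow_of_orthogonal h hk hx)

/-- The kernel of the adjoint, as a subspace. -/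
noncomputable abbrev wandering (T : H →L[ℂ] H) : Submodule ℂ H :=
  LinearMap.ker (adjoint T : H →ₗ[ℂ] H)

theorem isClosed_wandering (T : H →L[ℂ] H) : IsClosed (wandering T : Set H) :=
  (adjoint T).isClosed_ker

instance (T : H →L[ℂ] H) : CompleteSpace (wandering T) :=
  (isClosed_wandering T).completeSpace_coe

theorem topologicalClosure_iSup_wandering (h : IsTwoIsometry T) (hc : CompletelyNonUnitary T)
    (hk : KernelCondition T) :
    (⨆ n : ℕ, (wandering T).map
      ((T ^ n : H →L[ℂ] H) : H →ₗ[ℂ] H)).topologicalClosure = ⊤ := by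
  rw [Submodule.topologicalClosure_eq_top_iff, Submodule.eq_bot_iff]
  intro x hx
  refine eq_zero_of_orthogonal h hc hk fun e he k => hx _ ?_
  exact Submodule.mem_iSup_of_mem k ⟨e, he, rfl⟩

end Structure

/-! ### Orthogonal dimension and maps with dense range. -/

section Dimension

variable {N : Type u} [NormedAddCommGroup N] [InnerProductSpace ℂ N]
  {E : Type u} [NormedAddCommGroup E] [InnerProductSpace ℂ E]

/-- A continuous linear map with dense range does not increase the orthogonal dimension. -/
theorem mk_le_mk_of_denseRange {ι κ : Type u} (b : HilbertBasis ι ℂ N) (c : HilbertBasis κ ℂ E)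
    (F : N →L[ℂ] E) (hF : DenseRange F) : Cardinal.mk κ ≤ Cardinal.mk ι := by
  rcases finite_or_infinite ι with hι | hι
  · have := Fintype.ofFinite ι
    have : FiniteDimensional ℂ N := b.toOrthonormalBasis.toBasis.finiteDimensional_of_finite
    have hcl : IsClosed ((LinearMap.range (F : N →ₗ[ℂ] E) : Submodule ℂ E) : Set E) :=
      Submodule.closed_of_finiteDimensional _
    have hsurj : Function.Surjective (F : N →ₗ[ℂ] E) := by
      intro y
      have : y ∈ closure (Set.range F) := hF y
      have h2 : IsClosed (Set.range F) := hcl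
      rwa [h2.closure_eq] at this
    have h1 := c.orthonormal.linearIndependent.cardinal_le_rank
    have h2 := LinearMap.rank_le_of_surjective _ hsurj
    have h3 := rank_eq_card_basis b.toOrthonormalBasis.toBasis
    rw [h3, ← Cardinal.mk_fintype] at h2
    exact h1.trans h2
  -- Each `S i` is countable by Bessel, and they cover `κ`: a missed `c k` would be orthogonal to
  -- the dense range of `F`. So `κ` has at most `#ι · ℵ₀ = #ι` elements.
  · let S : ι → Set κ := fun i => {k | inner ℂ (c k) (F (b i)) ≠ 0}
    have hS : ∀ i, (S i).Countable := by
      intro i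
      have hs := c.orthonormal.inner_products_summable (F (b i))
      refine hs.countable_support.mono fun k hk => ?_
      have hk' : inner ℂ (c k) (F (b i)) ≠ 0 := hk
      simpa using hk'
    have hcov : ⋃ i, S i = Set.univ := by
      refine Set.eq_univ_of_forall fun k => ?_
      by_contra hk
      simp only [S, Set.mem_iUnion, Set.mem_ofPred_eq, not_exists, not_not] at hk
      have hzero : ((innerSL ℂ (c k)).comp F) = 0 := by
        refine ContinuousLinearMap.ext_on (s := Set.range b) ?_ ?_
        · have := b.dense_span
          rw [Submodule.dense_iff_topologicalClosure_eq_top]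
          exact this
        · rintro _ ⟨i, rfl⟩
          simpa using hk i
      have hz2 : ∀ y : E, inner ℂ (c k) y = 0 := by
        intro y
        have hcont : Continuous fun y : E => inner ℂ (c k) y := by fun_prop
        refine congrFun (hF.equalizer (g := fun y : E => inner ℂ (c k) y) (h := fun _ => (0 : ℂ))
          hcont continuous_const ?_) y
        funext z
        exact DFunLike.congr_fun hzero z
      have := hz2 (c k)
      rw [inner_self_eq_zero] at this
      exact c.orthonormal.ne_zero k this
    calc Cardinal.mk κ = Cardinal.mk (⋃ i, S i : Set κ) := by rw [hcov, Cardinal.mk_univ]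
      _ ≤ Cardinal.sum fun i => Cardinal.mk (S i) := Cardinal.mk_iUnion_le_sum_mk
      _ ≤ Cardinal.sum fun _ : ι => Cardinal.aleph0 :=
        Cardinal.sum_le_sum _ _ fun i => (hS i).le_aleph0
      _ = Cardinal.mk ι := by
        rw [Cardinal.sum_const', Cardinal.mul_aleph0_eq (Cardinal.aleph0_le_mk ι)]

theorem exists_hilbertBasis_mk_eq_orthDim (E : Type u) [NormedAddCommGroup E]
    [InnerProductSpace ℂ E] [CompleteSpace E] :
    ∃ ι : Type u, Nonempty (HilbertBasis ι ℂ E) ∧ Cardinal.mk ι = orthDim E := by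
  obtain ⟨w, b, -⟩ := exists_hilbertBasis ℂ E
  exact csInf_mem (s := {c | ∃ ι : Type u, Nonempty (HilbertBasis ι ℂ E) ∧ Cardinal.mk ι = c})
    ⟨_, w, ⟨b⟩, rfl⟩

theorem orthDim_eq_mk {κ : Type u} (c : HilbertBasis κ ℂ E) : orthDim E = Cardinal.mk κ := by
  refine le_antisymm (csInf_le' ⟨κ, ⟨c⟩, rfl⟩) (le_csInf ⟨_, κ, ⟨c⟩, rfl⟩ ?_)
  rintro _ ⟨ι, ⟨b⟩, rfl⟩
  exact mk_le_mk_of_denseRange b c (ContinuousLinearMap.id ℂ E) Function.surjective_id.denseRange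

end Dimension

/-! ### The order of multicyclicity equals the dimension of `ker T*`. -/

section Order

theorem orderOfMulticyclicity_set_nonempty {H : Type u} [NormedAddCommGroup H]
    [InnerProductSpace ℂ H] (T : H →L[ℂ] H) :
    {c | ∃ N : Submodule ℂ H, IsClosed (N : Set H) ∧ orthDim N = c ∧
      (⨆ n : ℕ, N.map ((T ^ n : H →L[ℂ] H) : H →ₗ[ℂ] H)).topologicalClosure = ⊤}.Nonempty := by
  refine ⟨_, ⊤, isClosed_univ, rfl, ?_⟩
  rw [eq_top_iff]
  refine le_trans ?_ (Submodule.le_topologicalClosure _)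
  exact le_iSup_of_le 0 fun x _ => ⟨x, trivial, by simp⟩

variable {H : Type u} [NormedAddCommGroup H] [InnerProductSpace ℂ H] [CompleteSpace H]
  {T : H →L[ℂ] H}

/-- A vector of `ker T*` is orthogonal to `ran T`; if it is also orthogonal to the projection of
`N`, it is orthogonal to every `Tⁿ(N)`, hence zero. -/
theorem denseRange_projection_wandering {N : Submodule ℂ H}
    (hN : (⨆ n : ℕ, N.map ((T ^ n : H →L[ℂ] H) : H →ₗ[ℂ] H)).topologicalClosure = ⊤) :
    DenseRange ((wandering T).orthogonalProjectionOnto.comp N.subtypeL) := by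
  let P := (wandering T).orthogonalProjectionOnto
  let R : Submodule ℂ (wandering T) := LinearMap.range (P.comp N.subtypeL : N →ₗ[ℂ] wandering T)
  have hR : R.topologicalClosure = ⊤ := by
    rw [Submodule.topologicalClosure_eq_top_iff, Submodule.eq_bot_iff]
    intro e he
    have hmem : (e : H) ∈ (⨆ n : ℕ, N.map ((T ^ n : H →L[ℂ] H) : H →ₗ[ℂ] H))ᗮ := by
      rw [← Submodule.iInf_orthogonal, Submodule.mem_iInf]
      rintro (_ | n)
      · rintro _ ⟨x, hx, rfl⟩
        have := he (P x) ⟨⟨x, hx⟩, rfl⟩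
        rw [Submodule.coe_inner] at this
        simpa [P, Submodule.inner_starProjection_left_eq_right,
          Submodule.starProjection_eq_self_iff.2 e.2] using this
      · rintro _ ⟨x, hx, rfl⟩
        rw [pow_succ']
        change inner ℂ (T ((T ^ n) x)) (e : H) = 0
        rw [← ContinuousLinearMap.adjoint_inner_right,
          show adjoint T (e : H) = 0 from e.2, inner_zero_right]
    rw [(Submodule.topologicalClosure_eq_top_iff).1 hN] at hmem
    simpa using hmem
  exact Submodule.dense_iff_topologicalClosure_eq_top.2 hR

theorem mk_le_orderOfMulticyclicity {κ : Type u} (c : HilbertBasis κ ℂ (wandering T)) :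
    Cardinal.mk κ ≤ orderOfMulticyclicity T := by
  refine le_csInf (orderOfMulticyclicity_set_nonempty T) ?_
  rintro _ ⟨N, hN, rfl, hspan⟩
  have : CompleteSpace N := hN.completeSpace_coe
  obtain ⟨ι, ⟨b⟩, hb⟩ := exists_hilbertBasis_mk_eq_orthDim N
  rw [← hb]
  exact mk_le_mk_of_denseRange b c _ (denseRange_projection_wandering hspan)

theorem orderOfMulticyclicity_eq_mk (h : IsTwoIsometry T) (hc : CompletelyNonUnitary T)
    (hk : KernelCondition T) {κ : Type u} (c : HilbertBasis κ ℂ (wandering T)) :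
    orderOfMulticyclicity T = Cardinal.mk κ :=
  le_antisymm (csInf_le' ⟨wandering T, isClosed_wandering T, orthDim_eq_mk c,
    topologicalClosure_iSup_wandering h hc hk⟩) (mk_le_orderOfMulticyclicity c)

end Order


/-! ### Finite multicyclicity: decomposition into weighted shifts. -/

section Shifts

variable {H : Type u} [NormedAddCommGroup H] [InnerProductSpace ℂ H] [CompleteSpace H]
  {T : H →L[ℂ] H}

theorem inner_linearIsometry_eq_zero {ι : Type*} {v : ι → H} (hv : Orthonormal ℂ v) {x : H}
    (hx : ∀ k, inner ℂ (v k) x = 0) (y : lp (fun _ : ι => ℂ) 2) :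
    inner ℂ (hv.orthogonalFamily.linearIsometry y) x = 0 := by
  have h1 := (hv.orthogonalFamily.hasSum_linearIsometry y).mapL (innerSL ℂ x)
  have h2 : ∀ k, innerSL ℂ x (LinearIsometry.toSpanSingleton ℂ H (hv.1 k) (y k)) = 0 := by
    intro k
    simp [inner_eq_zero_symm.1 (hx k)]
  simp only [h2] at h1
  exact inner_eq_zero_symm.1 (h1.unique hasSum_zero)

/-- An operator which shifts each row of a doubly indexed orthonormal basis is an orthogonal sum of
weighted shifts. -/
theorem equivOrthogonalSumOfShifts_of_orthonormal {J : Type v} {v : J → ℕ → H}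
    (hv : Orthonormal ℂ fun p : J × ℕ => v p.1 p.2)
    (htot : ∀ x : H, (∀ j k, inner ℂ (v j k) x = 0) → x = 0) {w : J → ℕ → ℂ}
    (hT : ∀ j k, T (v j k) = w j k • v j (k + 1)) : EquivOrthogonalSumOfShifts T J := by
  classical
  have hrow : ∀ j, Orthonormal ℂ (v j) := fun j =>
    hv.comp (fun k => (j, k)) fun a b hab => (Prod.ext_iff.1 hab).2
  let V : J → EllTwo →ₗᵢ[ℂ] H := fun j => (hrow j).orthogonalFamily.linearIsometry
  have hVsingle : ∀ j k, V j (lp.single 2 k (1 : ℂ)) = v j k := by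
    intro j k
    simp only [V]
    rw [OrthogonalFamily.linearIsometry_apply_single]
    simp
  have horth : OrthogonalFamily ℂ (fun _ : J => EllTwo) V := by
    intro i j hij x y
    refine inner_linearIsometry_eq_zero (hrow i) (fun k => ?_) x
    refine inner_eq_zero_symm.1 (inner_linearIsometry_eq_zero (hrow j) (fun l => ?_) y)
    exact hv.2 (i := (j, l)) (j := (i, k)) fun h => hij (Prod.ext_iff.1 h).1.symm
  have hsum : IsHilbertSum ℂ (fun _ : J => EllTwo) V := by
    refine IsHilbertSum.mk horth ?_
    rw [top_le_iff, Submodule.topologicalClosure_eq_top_iff, Submodule.eq_bot_iff]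
    intro x hx
    refine htot x fun j k => hx _ (Submodule.mem_iSup_of_mem j ⟨lp.single 2 k 1, hVsingle j k⟩)
  let U := hsum.linearIsometryEquiv
  have hUcoord : ∀ (h : H) j k, U h j k = inner ℂ (v j k) h := by
    intro h j k
    have h1 : U.symm (lp.single 2 j (lp.single 2 k (1 : ℂ))) = v j k := by
      rw [← hVsingle, hsum.linearIsometryEquiv_symm_apply_single]
    rw [← h1, ← U.inner_map_map, U.apply_symm_apply, lp.inner_single_left, lp.inner_single_left]
    simp
  have hadj0 : ∀ j, adjoint T (v j 0) = 0 := by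
    intro j
    refine htot _ fun i k => ?_
    rw [ContinuousLinearMap.adjoint_inner_right, hT, inner_smul_left,
      hv.2 (i := (i, k + 1)) (j := (j, 0)) (by simp), mul_zero]
  have hadj : ∀ j k, adjoint T (v j (k + 1)) = (starRingEnd ℂ) (w j k) • v j k := by
    intro j k
    refine sub_eq_zero.1 (htot _ fun i l => ?_)
    rw [inner_sub_right, ContinuousLinearMap.adjoint_inner_right, hT, inner_smul_left,
      inner_smul_right]
    have h1 := orthonormal_iff_ite.1 hv (i, l + 1) (j, k + 1)
    have h2 := orthonormal_iff_ite.1 hv (i, l) (j, k)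
    simp only at h1 h2
    rw [h1, h2]
    by_cases hh : i = j ∧ l = k
    · obtain ⟨rfl, rfl⟩ := hh; simp
    · simp [hh]
  let Uc : H →L[ℂ] lp (fun _ : J => EllTwo) 2 := (U.toContinuousLinearEquiv : _ →L[ℂ] _)
  let Us : lp (fun _ : J => EllTwo) 2 →L[ℂ] H := (U.symm.toContinuousLinearEquiv : _ →L[ℂ] _)
  let A : lp (fun _ : J => EllTwo) 2 →L[ℂ] lp (fun _ : J => EllTwo) 2 := Uc ∘L T ∘L Us
  have hA0 : ∀ x j, A x j 0 = 0 := by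
    intro x j
    change U (T (U.symm x)) j 0 = 0
    rw [hUcoord, ← ContinuousLinearMap.adjoint_inner_left, hadj0, inner_zero_left]
  have hA1 : ∀ x j k, A x j (k + 1) = w j k * x j k := by
    intro x j k
    change U (T (U.symm x)) j (k + 1) = _
    rw [hUcoord, ← ContinuousLinearMap.adjoint_inner_left, hadj, inner_smul_left, ← hUcoord,
      U.apply_symm_apply, Complex.conj_conj]
  -- As a compression of `A`, each summand is bounded without any estimate on the weights.
  let S : J → EllTwo →L[ℂ] EllTwo := fun j =>
    lp.evalCLM ℂ (fun _ : J => EllTwo) 2 j ∘L A ∘L lp.singleContinuousLinearMap ℂ (fun _ : J => EllTwo) 2 j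
  have hS : ∀ j y k, S j y k = A (lp.single 2 j y) j k := fun j y k => rfl
  refine ⟨S, A, fun j => ⟨w j, fun h => ⟨?_, fun k => ?_⟩⟩, fun x j => ?_, U, fun x => ?_⟩
  · rw [hS, hA0]
  · rw [hS, hA1, lp.single_apply_self]
  · refine lp.ext (funext fun k => ?_)
    rw [hS]
    cases k with
    | zero => rw [hA0, hA0]
    | succ k => rw [hA1, hA1, lp.single_apply_self]
  · change U (T x) = U (T (U.symm (U x)))
    rw [U.symm_apply_apply]

/-- The kernel condition makes `ker T*` invariant under `T*T`, so the finite-dimensional spectral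
theorem applies to the restriction. -/
theorem exists_diagonalizing_basis (hk : KernelCondition T)
    [FiniteDimensional ℂ (wandering T)] {n : ℕ} (hn : Module.finrank ℂ (wandering T) = n) :
    ∃ e : OrthonormalBasis (Fin n) ℂ (wandering T),
      ∀ i j, i ≠ j → inner ℂ (T (e i)) (T (e j)) = 0 := by
  let D : wandering T →ₗ[ℂ] wandering T :=
    ((adjoint T * T : H →L[ℂ] H) : H →ₗ[ℂ] H).restrict hk
  have hDin : ∀ x y : wandering T, inner ℂ x (D y) = inner ℂ (T x) (T y) := by
    intro x y
    change inner ℂ (x : H) (adjoint T (T y)) = _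
    rw [ContinuousLinearMap.adjoint_inner_right]
  have hD : D.IsSymmetric := by
    intro x y
    rw [hDin, ← inner_conj_symm, hDin, inner_conj_symm]
  refine ⟨hD.eigenvectorBasis hn, fun i j hij => ?_⟩
  rw [← hDin, hD.apply_eigenvectorBasis, inner_smul_right,
    (hD.eigenvectorBasis hn).orthonormal.2 hij, mul_zero]

theorem equivOrthogonalSumOfShifts_of_finrank (h : IsTwoIsometry T) (hc : CompletelyNonUnitary T)
    (hk : KernelCondition T) [FiniteDimensional ℂ (wandering T)] {n : ℕ}
    (hn : Module.finrank ℂ (wandering T) = n) : EquivOrthogonalSumOfShifts T (Fin n) := by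
  obtain ⟨e, he⟩ := exists_diagonalizing_basis hk hn
  have hpne : ∀ i (k : ℕ), (T ^ k) (e i) ≠ 0 := by
    intro i k h0
    have h1 : (e i : H) = 0 := by
      have hinj : Function.Injective (T ^ k) := by
        rw [FunLike.coe_pow_eq_iterate]
        exact h.injective.iterate k
      exact hinj (by rw [h0, map_zero])
    exact e.orthonormal.ne_zero i (Subtype.ext h1)
  have hker : ∀ i, adjoint T (e i : H) = 0 := fun i => (e i).2
  have horth : ∀ i j (k l : ℕ), (i, k) ≠ (j, l) →
      inner ℂ ((T ^ k) (e i : H)) ((T ^ l) (e j : H)) = 0 := by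
    intro i j k l hne
    rcases lt_trichotomy k l with hkl | rfl | hkl
    · exact inner_pow_pow_eq_zero' h hk (hker i) hkl _
    · have hij : i ≠ j := fun hij => hne (by rw [hij])
      have : inner ℂ (e i : H) (e j : H) = 0 := e.orthonormal.2 hij
      rw [h.inner_pow, he i j hij, this]
      simp
    · exact inner_pow_pow_eq_zero h hk (hker j) hkl _
  let c : Fin n → ℕ → ℂ := fun i k => (‖(T ^ k) (e i : H)‖ : ℂ)⁻¹
  have hcne : ∀ i k, c i k ≠ 0 := fun i k =>
    inv_ne_zero (Complex.ofReal_ne_zero.2 (norm_ne_zero_iff.2 (hpne i k)))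
  -- After normalizing the orbit of `e i`, the weights are `‖Tᵏ⁺¹eᵢ‖ / ‖Tᵏeᵢ‖`.
  refine equivOrthogonalSumOfShifts_of_orthonormal (v := fun i k => c i k • (T ^ k) (e i : H))
    (w := fun i k => c i k * (c i (k + 1))⁻¹) ⟨?_, ?_⟩ ?_ ?_
  · rintro ⟨i, k⟩
    simp only [c, norm_smul, norm_inv, Complex.norm_real, norm_norm]
    exact inv_mul_cancel₀ (norm_ne_zero_iff.2 (hpne i k))
  · rintro ⟨i, k⟩ ⟨j, l⟩ hne
    simp only [inner_smul_left, inner_smul_right]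
    rw [horth i j k l hne, mul_zero, mul_zero]
  · intro x hx
    refine eq_zero_of_orthogonal h hc hk fun y hy k => ?_
    have hsum := e.sum_repr ⟨y, hy⟩
    have hy' : y = ∑ i, e.repr ⟨y, hy⟩ i • (e i : H) := by
      have := congrArg (Subtype.val : wandering T → H) hsum
      simpa using this.symm
    rw [hy', map_sum, sum_inner]
    refine Finset.sum_eq_zero fun i _ => ?_
    have := hx i k
    rw [inner_smul_left] at this
    rw [map_smul, inner_smul_left]
    rw [(mul_eq_zero.1 this).resolve_left (by simpa using hcne i k), mul_zero]
  · intro i k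
    rw [map_smul, smul_smul, pow_succ', mul_apply_eq_comp, mul_assoc,
      inv_mul_cancel₀ (hcne i (k + 1)), mul_one]

theorem exists_equivOrthogonalSumOfShifts_fin (hf : FinitelyMulticyclic T)
    (hc : CompletelyNonUnitary T) (h : IsTwoIsometry T) (hk : KernelCondition T) :
    ∃ n : ℕ, orderOfMulticyclicity T = (n : Cardinal.{u}) ∧
      EquivOrthogonalSumOfShifts T (Fin n) := by
  obtain ⟨κ, ⟨b⟩, -⟩ := exists_hilbertBasis_mk_eq_orthDim (wandering T)
  have horder := orderOfMulticyclicity_eq_mk h hc hk b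
  have : Finite κ := Cardinal.lt_aleph0_iff_finite.1 (horder ▸ hf)
  have := Fintype.ofFinite κ
  have : FiniteDimensional ℂ (wandering T) :=
    b.toOrthonormalBasis.toBasis.finiteDimensional_of_finite
  refine ⟨Fintype.card κ, by rw [horder, Cardinal.mk_fintype],
    equivOrthogonalSumOfShifts_of_finrank h hc hk ?_⟩
  exact Module.finrank_eq_card_basis b.toOrthonormalBasis.toBasis

end Shifts


/-! ### The obstruction: an eigenvector in `ker T*`. -/

section Eigenvector

variable {H : Type u} [NormedAddCommGroup H] [InnerProductSpace ℂ H] [CompleteSpace H]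
  {T : H →L[ℂ] H}

/-- For an orthogonal sum of weighted shifts, `T^*T` has an eigenvector in `ker T^*`. -/
theorem EquivOrthogonalSumOfShifts.exists_eigenvector [Nontrivial H] {J : Type v}
    (h : EquivOrthogonalSumOfShifts T J) :
    ∃ g : H, g ≠ 0 ∧ adjoint T g = 0 ∧
      ∃ r : ℂ, ∀ y, inner ℂ (T g) (T y) = r * inner ℂ g y := by
  classical
  obtain ⟨S, A, hS, hA, U, hU⟩ := h
  have hJ : Nonempty J := by
    by_contra hJ
    rw [not_nonempty_iff] at hJ
    obtain ⟨x, hx⟩ := exists_ne (0 : H)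
    refine hx (U.injective (lp.ext (funext fun j => hJ.elim j)))
  obtain ⟨j⟩ := hJ
  obtain ⟨w, hw⟩ := hS j
  -- The zeroth basis vector of one summand is orthogonal to `ran A`; its eigenvalue is `|w 0|²`.
  let e : lp (fun _ : J => EllTwo) 2 := lp.single 2 j (lp.single 2 0 (1 : ℂ))
  have hAe : A e = w 0 • lp.single 2 j (lp.single 2 1 (1 : ℂ)) := by
    refine lp.ext (funext fun i => ?_)
    rw [hA]
    by_cases hij : i = j
    · subst hij
      refine lp.ext (funext fun k => ?_)
      simp only [e, lp.coeFn_smul, Pi.smul_apply, lp.single_apply_self]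
      rcases k with _ | _ | k
      · rw [(hw _).1]
        simp
      · rw [(hw _).2]
        simp
      · rw [(hw _).2]
        simp
    · simp only [e, lp.coeFn_smul, Pi.smul_apply, lp.single_apply_ne 2 j _ hij, map_zero, smul_zero]
  have he : ∀ z, inner ℂ e z = z j 0 := by
    intro z
    simp only [e]
    rw [lp.inner_single_left, lp.inner_single_left]
    simp
  refine ⟨U.symm e, ?_, ?_, (starRingEnd ℂ) (w 0) * w 0, fun y => ?_⟩
  · intro h0
    have h1 : e = 0 := by rw [← U.apply_symm_apply e, h0, map_zero]
    have h2 := he e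
    rw [h1] at h2
    have h3 : e j 0 = 1 := by simp [e]
    rw [h1] at h3
    simp at h3
  · refine ext_inner_right ℂ fun y => ?_
    rw [ContinuousLinearMap.adjoint_inner_left, inner_zero_left, ← U.inner_map_map,
      U.apply_symm_apply, hU, he, hA, (hw _).1]
  · rw [← U.inner_map_map, ← U.inner_map_map (U.symm e), hU, hU, U.apply_symm_apply, he, hAe,
      inner_smul_left, lp.inner_single_left, lp.inner_single_left, hA, (hw _).2]
    simp [mul_assoc]

end Eigenvector

/-! ### Operator weighted shifts and the 2-isometric model. -/

section OperatorShift

variable {E : Type u} [NormedAddCommGroup E] [InnerProductSpace ℂ E]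

/-- `T` is the unilateral shift with operator weights `W n`. -/
def IsOperatorShift (W : ℕ → E →L[ℂ] E)
    (T : lp (fun _ : ℕ => E) 2 →L[ℂ] lp (fun _ : ℕ => E) 2) : Prop :=
  ∀ x, T x 0 = 0 ∧ ∀ n, T x (n + 1) = W n (x n)

theorem exists_isOperatorShift {W : ℕ → E →L[ℂ] E} {K : ℝ} (hW : ∀ n x, ‖W n x‖ ≤ K * ‖x‖) :
    ∃ T, IsOperatorShift W T := by
  let f : (ℕ → E) → ℕ → E := fun x n => Nat.casesOn n 0 fun n => W n (x n)
  have hsq : ∀ n x, ‖W n x‖ ^ 2 ≤ K ^ 2 * ‖x‖ ^ 2 := fun n x => by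
    rw [← mul_pow]
    exact pow_le_pow_left₀ (norm_nonneg _) (hW n x) 2
  have hsum : ∀ x : lp (fun _ : ℕ => E) 2, HasSum (fun n => ‖x n‖ ^ 2) (‖x‖ ^ 2) := fun x => by
    simpa using lp.hasSum_norm (by norm_num) x
  have hW' : ∀ x : lp (fun _ : ℕ => E) 2, Summable fun n => ‖W n (x n)‖ ^ 2 := fun x =>
    Summable.of_nonneg_of_le (fun _ => by positivity) (fun n => hsq n (x n))
      ((hsum x).summable.mul_left (K ^ 2))
  have hf : ∀ x : lp (fun _ : ℕ => E) 2, Summable fun n => ‖f x n‖ ^ 2 := fun x =>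
    (summable_nat_add_iff 1).1 (hW' x)
  have hmem : ∀ x : lp (fun _ : ℕ => E) 2, Memℓp (f x) 2 := fun x =>
    memℓp_gen (by simpa using hf x)
  let T₀ : lp (fun _ : ℕ => E) 2 →ₗ[ℂ] lp (fun _ : ℕ => E) 2 :=
    { toFun := fun x => ⟨f x, hmem x⟩
      map_add' := fun x y => lp.ext <| funext fun n => by
        cases n with
        | zero => exact (add_zero (0 : E)).symm
        | succ n => exact map_add (W n) _ _
      map_smul' := fun c x => lp.ext <| funext fun n => by
        cases n with
        | zero => exact (smul_zero c).symm
        | succ n => exact map_smul (W n) _ _ }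
  refine ⟨T₀.mkContinuous |K| fun x => ?_, fun x => ⟨rfl, fun n => rfl⟩⟩
  refine le_of_sq_le_sq ?_ (by positivity)
  rw [mul_pow, sq_abs, ← (hsum (T₀ x)).tsum_eq, ← (hsum x).tsum_eq, ← tsum_mul_left,
    (hsum (T₀ x)).summable.tsum_eq_zero_add]
  have h0 : ‖T₀ x 0‖ ^ 2 = 0 := by
    change ‖(0 : E)‖ ^ 2 = 0
    simp
  rw [h0, zero_add]
  exact (hW' x).tsum_le_tsum (fun n => hsq n (x n)) ((hsum x).summable.mul_left (K ^ 2))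

variable {W : ℕ → E →L[ℂ] E} {T : lp (fun _ : ℕ => E) 2 →L[ℂ] lp (fun _ : ℕ => E) 2}

theorem IsOperatorShift.apply_single (hT : IsOperatorShift W T) (n : ℕ) (a : E) :
    T (lp.single 2 n a) = lp.single 2 (n + 1) (W n a) := by
  refine lp.ext (funext fun m => ?_)
  rcases m with _ | m
  · rw [(hT _).1, lp.single_apply_ne _ _ _ (by omega)]
  · rw [(hT _).2]
    by_cases hm : m = n
    · subst hm
      rw [lp.single_apply_self, lp.single_apply_self]
    · rw [lp.single_apply_ne _ _ _ hm, lp.single_apply_ne _ _ _ (by omega), map_zero]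

theorem IsOperatorShift.hasSum_inner (hT : IsOperatorShift W T) (x y : lp (fun _ : ℕ => E) 2) :
    HasSum (fun n => inner ℂ (W n (x n)) (W n (y n))) (inner ℂ (T x) (T y)) := by
  have h := lp.hasSum_inner (𝕜 := ℂ) (T x) (T y)
  rw [← hasSum_nat_add_iff' 1] at h
  simpa [(hT _).1, (hT _).2] using h

theorem IsOperatorShift.hasSum_inner_sq (hT : IsOperatorShift W T)
    (x y : lp (fun _ : ℕ => E) 2) :
    HasSum (fun n => inner ℂ (W (n + 1) (W n (x n))) (W (n + 1) (W n (y n))))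
      (inner ℂ (T (T x)) (T (T y))) := by
  have h := hT.hasSum_inner (T x) (T y)
  rw [← hasSum_nat_add_iff' 1] at h
  simpa [(hT _).1, (hT _).2] using h

variable [CompleteSpace E]

theorem IsOperatorShift.adjoint_single_zero (hT : IsOperatorShift W T) (a : E) :
    adjoint T (lp.single 2 0 a) = 0 := by
  refine ext_inner_right ℂ fun y => ?_
  rw [ContinuousLinearMap.adjoint_inner_left, lp.inner_single_left, (hT y).1, inner_zero_right,
    inner_zero_left]

/-- Surjectivity of `W n` puts the vector with sole entry `g (n + 1)` at position `n + 1` into `ran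
T`, so that entry is orthogonal to itself. -/
theorem IsOperatorShift.eq_single_zero (hT : IsOperatorShift W T)
    (hW : ∀ n, Function.Surjective (W n)) {g : lp (fun _ : ℕ => E) 2} (hg : adjoint T g = 0) :
    g = lp.single 2 0 (g 0) := by
  refine lp.ext (funext fun n => ?_)
  rcases n with _ | n
  · rw [lp.single_apply_self]
  · rw [lp.single_apply_ne _ _ _ (by omega)]
    obtain ⟨a, ha⟩ := hW n (g (n + 1))
    have h1 : inner ℂ g (T (lp.single 2 n a)) = 0 := by
      rw [← ContinuousLinearMap.adjoint_inner_left, hg, inner_zero_left]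
    rw [hT.apply_single, ha, lp.inner_single_right, inner_self_eq_zero] at h1
    exact h1

theorem IsOperatorShift.kernelCondition (hT : IsOperatorShift W T)
    (hW : ∀ n, Function.Surjective (W n)) : KernelCondition T := by
  intro g hg
  refine ext_inner_right ℂ fun y => ?_
  rw [mul_apply_eq_comp, ContinuousLinearMap.adjoint_inner_left,
    ContinuousLinearMap.adjoint_inner_left, hT.eq_single_zero hW hg, hT.apply_single,
    lp.inner_single_left, (hT (T y)).2, (hT y).1]
  simp

/-- On `L` every vector is `T` of a vector of `L`, and each application of `T` pushes the vanishing
of coordinates one place further. -/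
theorem IsOperatorShift.completelyNonUnitary (hT : IsOperatorShift W T) :
    CompletelyNonUnitary T := by
  rintro ⟨L, hL, -, -, U, hU⟩
  have key : ∀ n, ∀ x ∈ L, x n = 0 := by
    intro n
    induction n with
    | zero =>
      intro x hx
      have := hU (U.symm ⟨x, hx⟩)
      rw [U.apply_symm_apply] at this
      change x = _ at this
      rw [this, (hT _).1]
    | succ n ih =>
      intro x hx
      have := hU (U.symm ⟨x, hx⟩)
      rw [U.apply_symm_apply] at this
      change x = _ at this
      rw [this, (hT _).2, ih _ (U.symm ⟨x, hx⟩).2, map_zero]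
  refine hL ((Submodule.eq_bot_iff _).2 fun x hx => lp.ext (funext fun n => key n x hx))

/-- The subspace `ker T^*` of an operator weighted shift is a copy of the coefficient space. -/
theorem IsOperatorShift.nonempty_equiv_wandering (hT : IsOperatorShift W T)
    (hW : ∀ n, Function.Surjective (W n)) : Nonempty (E ≃ₗᵢ[ℂ] wandering T) := by
  have hnorm : ∀ a : E, ‖(lp.single 2 0 a : lp (fun _ : ℕ => E) 2)‖ = ‖a‖ := fun a =>
    lp.norm_single (E := fun _ : ℕ => E) (by norm_num) 0 a
  let f : E →ₗᵢ[ℂ] wandering T :=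
    { toFun := fun a => ⟨lp.single 2 0 a, hT.adjoint_single_zero a⟩
      map_add' := fun a b => Subtype.ext (lp.single_add (E := fun _ : ℕ => E) 2 0 a b)
      map_smul' := fun c a => Subtype.ext (lp.single_smul (E := fun _ : ℕ => E) 2 0 c a)
      norm_map' := fun a => hnorm a }
  refine ⟨LinearIsometryEquiv.ofSurjective f ?_⟩
  rintro ⟨g, hg⟩
  exact ⟨g 0, Subtype.ext (hT.eq_single_zero hW hg).symm⟩

/-- Factors `R m` of the operators `1 + m C^*C`. -/
theorem exists_units_inner_eq (C : E →L[ℂ] E) :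
    ∃ R : ℕ → (E →L[ℂ] E)ˣ, ∀ m x y,
      inner ℂ ((R m : E →L[ℂ] E) x) ((R m : E →L[ℂ] E) y) =
        inner ℂ x y + m * inner ℂ (C x) (C y) := by
  have hpos : ∀ m : ℕ, IsStrictlyPositive (1 + m • (star C * C) : E →L[ℂ] E) := fun m =>
    IsStrictlyPositive.add_nonneg isStrictlyPositive_one (nsmul_nonneg (star_mul_self_nonneg C) m)
  choose R hR using fun m => (hpos m).isUnit_cfcSqrt
  refine ⟨R, fun m x y => ?_⟩
  have hsq : star (R m : E →L[ℂ] E) * (R m : E →L[ℂ] E) = 1 + m • (star C * C) := by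
    rw [hR, (CFC.sqrt_nonneg _).isSelfAdjoint.star_eq, CFC.sqrt_mul_sqrt_self _ (hpos m).nonneg]
  rw [← ContinuousLinearMap.adjoint_inner_right]
  have := DFunLike.congr_fun hsq y
  rw [mul_apply_eq_comp, ContinuousLinearMap.star_eq_adjoint] at this
  rw [this, ContinuousLinearMap.star_eq_adjoint]
  simp [inner_add_right, inner_smul_right, ContinuousLinearMap.adjoint_inner_right,
    ← Nat.cast_smul_eq_nsmul ℂ]

/-- A `2`-isometric operator weighted shift `T` with `T^*T` equal to `1 + C^*C` on `ker T^*`. -/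
theorem exists_twoIsometry_isOperatorShift (C : E →L[ℂ] E) :
    ∃ W T, IsOperatorShift (E := E) W T ∧ (∀ n, Function.Surjective (W n)) ∧ IsTwoIsometry T ∧
      ∃ V : E ≃ E, ∀ x y, inner ℂ (V x) (V y) = inner ℂ x y ∧
        inner ℂ (W 0 (V x)) (W 0 (V y)) = inner ℂ x y + inner ℂ (C x) (C y) := by
  obtain ⟨R, hR⟩ := exists_units_inner_eq C
  have hinv : ∀ n x, (R n : E →L[ℂ] E) ((↑(R n)⁻¹ : E →L[ℂ] E) x) = x := fun n x => by
    rw [← mul_apply_eq_comp, Units.mul_inv, one_apply_eq_self]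
  have hinv' : ∀ n x, (↑(R n)⁻¹ : E →L[ℂ] E) ((R n : E →L[ℂ] E) x) = x := fun n x => by
    rw [← mul_apply_eq_comp, Units.inv_mul, one_apply_eq_self]
  -- With the `n`-th coordinate written `R n a`, the weights act by `R n a ↦ R (n + 1) a`. Squared
  -- norms become `‖a‖² + n‖C a‖²`, affine in `n`: this yields both the 2-isometry identity and a
  -- bound uniform in `n`.
  let W : ℕ → E →L[ℂ] E := fun n => (R (n + 1) : E →L[ℂ] E) * (↑(R n)⁻¹ : E →L[ℂ] E)
  have hWR : ∀ n x, W n ((R n : E →L[ℂ] E) x) = (R (n + 1) : E →L[ℂ] E) x := fun n x => by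
    rw [mul_apply_eq_comp, hinv']
  have hsurj : ∀ n, Function.Surjective (W n) := fun n y =>
    ⟨(R n : E →L[ℂ] E) ((↑(R (n + 1))⁻¹ : E →L[ℂ] E) y), by rw [hWR, hinv]⟩
  have hnorm : ∀ m x, ‖(R m : E →L[ℂ] E) x‖ ^ 2 = ‖x‖ ^ 2 + m * ‖C x‖ ^ 2 := fun m x => by
    have := hR m x x
    simp only [inner_self_eq_norm_sq_to_K, Complex.coe_algebraMap] at this
    exact_mod_cast this
  have hbound : ∀ n x, ‖W n x‖ ≤ (1 + ‖C‖) * ‖x‖ := by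
    intro n x
    obtain ⟨y, rfl⟩ : ∃ y, (R n : E →L[ℂ] E) y = x := ⟨_, hinv n x⟩
    rw [hWR]
    refine le_of_sq_le_sq ?_ (by positivity)
    rw [mul_pow, hnorm, hnorm]
    have h1 : ‖C y‖ ^ 2 ≤ ‖C‖ ^ 2 * ‖y‖ ^ 2 := by
      rw [← mul_pow]
      exact pow_le_pow_left₀ (norm_nonneg _) (C.le_opNorm y) 2
    have h2 : 0 ≤ ‖C‖ := norm_nonneg C
    have h3 : 0 ≤ (n : ℝ) * ‖C y‖ ^ 2 := by positivity
    push_cast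
    nlinarith [sq_nonneg ‖y‖, mul_nonneg h2 h3, mul_nonneg (sq_nonneg ‖C‖) h3,
      mul_nonneg h2 (sq_nonneg ‖y‖)]
  obtain ⟨T, hT⟩ := exists_isOperatorShift hbound
  refine ⟨W, T, hT, hsurj, isTwoIsometry_iff_inner.2 fun x y => ?_,
    ⟨(R 0 : E →L[ℂ] E), (↑(R 0)⁻¹ : E →L[ℂ] E), hinv' 0, hinv 0⟩, fun x y => ⟨?_, ?_⟩⟩
  · refine (hT.hasSum_inner_sq x y).unique ?_
    convert! ((hT.hasSum_inner x y).mul_left 2).sub (lp.hasSum_inner (𝕜 := ℂ) x y) using 1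
    funext n
    obtain ⟨a, ha⟩ : ∃ a, (R n : E →L[ℂ] E) a = x n := ⟨_, hinv n _⟩
    obtain ⟨b, hb⟩ : ∃ b, (R n : E →L[ℂ] E) b = y n := ⟨_, hinv n _⟩
    rw [← ha, ← hb, hWR, hWR, hWR, hWR, hR, hR, hR]
    push_cast
    ring
  · simpa using hR 0 x y
  · simp only [Equiv.coe_fn_mk]
    rw [hWR, hWR, hR]
    simp

end OperatorShift

/-! ### An operator without eigenvectors and the counterexample. -/

section NoEigenvector

open Filter Topology

/-- The recurrence conserves `x (k+1)² + x k² - r x k x (k+1)`, which equals `x 0²` and tends to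
`0`; so `x 0 = 0`, and the rest follows. -/
theorem eq_zero_of_recurrence {x : ℕ → ℂ} {r : ℂ} (h1 : x 1 = r * x 0)
    (h2 : ∀ k, x (k + 2) = r * x (k + 1) - x k) (hx : Tendsto x atTop (𝓝 0)) (k : ℕ) :
    x k = 0 := by
  have hq : ∀ k, x (k + 1) ^ 2 + x k ^ 2 - r * x k * x (k + 1) = x 0 ^ 2 := by
    intro k
    induction k with
    | zero => rw [zero_add, h1]; ring
    | succ k ih => rw [h2, ← ih]; ring
  have hx' := hx.comp (tendsto_add_atTop_nat 1)
  have hlim : Tendsto (fun k => x (k + 1) ^ 2 + x k ^ 2 - r * x k * x (k + 1)) atTop (𝓝 0) := by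
    have := ((hx'.pow 2).add (hx.pow 2)).sub ((hx.const_mul r).mul hx')
    simpa using this
  simp only [hq] at hlim
  have h0 : x 0 = 0 := by
    exact pow_eq_zero_iff two_ne_zero |>.1 (tendsto_nhds_unique tendsto_const_nhds hlim)
  have : x k = 0 ∧ x (k + 1) = 0 := by
    induction k with
    | zero => exact ⟨h0, by rw [zero_add, h1, h0, mul_zero]⟩
    | succ k ih => exact ⟨ih.2, by rw [h2, ih.1, ih.2, mul_zero, sub_zero]⟩
  exact this.1

variable {E : Type u} [NormedAddCommGroup E] [InnerProductSpace ℂ E]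

theorem exists_linearIsometry_map_basis [CompleteSpace E] {κ : Type u} (b : HilbertBasis κ ℂ E)
    {σ : κ → κ} (hσ : Function.Injective σ) :
    ∃ S : E →ₗᵢ[ℂ] E, (∀ p, S (b p) = b (σ p)) ∧
      ∀ u q, q ∉ Set.range σ → inner ℂ (S u) (b q) = 0 := by
  classical
  have hb : Orthonormal ℂ fun p => b (σ p) := b.orthonormal.comp σ hσ
  refine ⟨hb.orthogonalFamily.linearIsometry.comp b.repr.toLinearIsometry, fun p => ?_,
    fun u q hq => inner_linearIsometry_eq_zero hb (fun p => b.orthonormal.2 fun h => hq ⟨p, h⟩) _⟩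
  change hb.orthogonalFamily.linearIsometry (b.repr (b p)) = b (σ p)
  rw [b.repr_self, OrthogonalFamily.linearIsometry_apply_single]
  simp

/-- If `S` is a shift of arbitrary multiplicity then `(1 + S)^*(1 + S)` has no eigenvectors. -/
theorem exists_operator_without_eigenvector [CompleteSpace E] {ι : Type u}
    (b : HilbertBasis (ι × ℕ) ℂ E) :
    ∃ C : E →L[ℂ] E, ∀ (r : ℂ) u, (∀ z, inner ℂ (C u) (C z) = r * inner ℂ u z) → u = 0 := by
  obtain ⟨S, hSb, hS⟩ := exists_linearIsometry_map_basis b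
    (σ := fun p => (p.1, p.2 + 1)) fun p q hpq => by
      simp only [Prod.mk.injEq, add_left_inj] at hpq
      exact Prod.ext hpq.1 hpq.2
  have hS0 : ∀ u i, inner ℂ (S u) (b (i, 0)) = 0 := fun u i => hS u _ (by simp)
  have hS1 : ∀ u i k, inner ℂ (S u) (b (i, k + 1)) = inner ℂ u (b (i, k)) := fun u i k => by
    rw [← S.inner_map_map u, hSb]
  refine ⟨1 + S.toContinuousLinearMap, fun r u hu => ?_⟩
  -- Testing against `b (i, k)` gives a three-term recurrence along each row, with parameter `r - 2`
  -- since `C*C = 2 + S + S*`.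
  have hrec : ∀ i k, (inner ℂ u (b (i, k)) + inner ℂ (S u) (b (i, k))) +
      (inner ℂ u (b (i, k + 1)) + inner ℂ u (b (i, k))) = r * inner ℂ u (b (i, k)) := by
    intro i k
    have h := hu (b (i, k))
    have hC : ∀ z, (1 + S.toContinuousLinearMap) z = z + S z := fun z => rfl
    rw [hC, hC, hSb, inner_add_right, inner_add_left, inner_add_left, hS1] at h
    exact h
  have hzero : ∀ i k, inner ℂ u (b (i, k)) = 0 := by
    intro i k
    refine eq_zero_of_recurrence (x := fun k => inner ℂ u (b (i, k))) (r := r - 2) ?_ ?_ ?_ k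
    · have := hrec i 0
      rw [hS0] at this
      linear_combination this
    · intro k
      have := hrec i (k + 1)
      rw [hS1] at this
      linear_combination this
    · have h2 : Summable fun k => ‖inner ℂ (b (i, k)) u‖ ^ 2 :=
        (b.orthonormal.inner_products_summable u).comp_injective (i := fun k : ℕ => (i, k))
          fun a b hab => (Prod.ext_iff.1 hab).2
      rw [tendsto_zero_iff_norm_tendsto_zero]
      simpa [norm_inner_symm u] using h2.tendsto_atTop_zero.sqrt
  refine b.repr.injective (lp.ext (funext fun p => ?_))
  rw [b.repr_apply_apply, inner_eq_zero_symm.1 (hzero p.1 p.2), map_zero]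
  rfl

end NoEigenvector

theorem exists_not_equivOrthogonalSumOfShifts {n : Cardinal.{u}} (hn : Cardinal.aleph0 ≤ n) :
    ∃ (H : Type u) (_ : NormedAddCommGroup H) (_ : InnerProductSpace ℂ H)
      (_ : CompleteSpace H) (T : H →L[ℂ] H),
      CompletelyNonUnitary T ∧ IsTwoIsometry T ∧ KernelCondition T ∧
        orderOfMulticyclicity T = n ∧ ∀ J : Type v, ¬ EquivOrthogonalSumOfShifts T J := by
  classical
  -- Here `n ≥ ℵ₀` enters: a shift of multiplicity `n` lives on a space of dimension `n · ℵ₀ = n`.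
  have hcard : Cardinal.mk (n.out × ℕ) = n := by
    simp [Cardinal.mul_aleph0_eq hn]
  have : Nonempty (n.out × ℕ) := by
    rw [← Cardinal.mk_ne_zero_iff, hcard]
    exact (Cardinal.aleph0_pos.trans_le hn).ne'
  obtain ⟨p⟩ := this
  obtain ⟨C, hC⟩ := exists_operator_without_eigenvector
    (default : HilbertBasis (n.out × ℕ) ℂ (lp (fun _ : n.out × ℕ => ℂ) 2))
  obtain ⟨W, T, hT, hW, h2, V, hV⟩ := exists_twoIsometry_isOperatorShift C
  have hk := hT.kernelCondition hW
  have hc := hT.completelyNonUnitary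
  refine ⟨_, inferInstance, inferInstance, inferInstance, T, hc, h2, hk, ?_, fun J hJ => ?_⟩
  · obtain ⟨f⟩ := hT.nonempty_equiv_wandering hW
    rw [orderOfMulticyclicity_eq_mk h2 hc hk (HilbertBasis.ofRepr f.symm), hcard]
  · have : Nontrivial (lp (fun _ : ℕ => lp (fun _ : n.out × ℕ => ℂ) 2) 2) := by
      refine ⟨⟨lp.single 2 0 (lp.single 2 p 1), 0, fun h => ?_⟩⟩
      have := congrArg (fun x : lp (fun _ : ℕ => lp (fun _ : n.out × ℕ => ℂ) 2) 2 => x 0 p) h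
      simp at this
    obtain ⟨g, hg0, hg, r, hr⟩ := hJ.exists_eigenvector
    have hgs := hT.eq_single_zero hW hg
    obtain ⟨a, ha⟩ := V.surjective (g 0)
    -- Transported by `V`, the eigenvector of `T*T` for `r` becomes one of `C*C` for `r - 1`.
    have ha0 : a = 0 := by
      refine hC (r - 1) a fun z => ?_
      have h := hr (lp.single 2 0 (V z))
      rw [hgs, ← ha, hT.apply_single, hT.apply_single, lp.inner_single_left, lp.inner_single_left,
        lp.single_apply_self, lp.single_apply_self, (hV a z).1, (hV a z).2] at h
      linear_combination h
    refine hg0 ?_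
    have hV0 : V 0 = 0 := by
      have := (hV 0 0).1
      rwa [inner_zero_left, inner_self_eq_zero] at this
    rw [hgs, ← ha, ha0, hV0, lp.single_zero]

end TwoIsom

theorem corollary3p7 :
    (∀ (H : Type u) [NormedAddCommGroup H] [InnerProductSpace ℂ H] [CompleteSpace H]
        (T : H →L[ℂ] H),
        TwoIsom.FinitelyMulticyclic T → TwoIsom.CompletelyNonUnitary T →
        TwoIsom.IsTwoIsometry T → TwoIsom.KernelCondition T →
        ∃ n : ℕ, TwoIsom.orderOfMulticyclicity T = (n : Cardinal.{u}) ∧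
          TwoIsom.EquivOrthogonalSumOfShifts T (Fin n)) ∧
    (∀ n : Cardinal.{u}, Cardinal.aleph0 ≤ n →
        ∃ (H : Type u) (_ : NormedAddCommGroup H) (_ : InnerProductSpace ℂ H)
          (_ : CompleteSpace H) (T : H →L[ℂ] H),
          TwoIsom.CompletelyNonUnitary T ∧ TwoIsom.IsTwoIsometry T ∧
          TwoIsom.KernelCondition T ∧ TwoIsom.orderOfMulticyclicity T = n ∧
          ∀ J : Type v, ¬ TwoIsom.EquivOrthogonalSumOfShifts T J) :=
  ⟨fun _ _ _ _ _ hf hc h hk => TwoIsom.exists_equivOrthogonalSumOfShifts_fin hf hc h hk,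
    fun _ hn => TwoIsom.exists_not_equivOrthogonalSumOfShifts hn⟩
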